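/- Let $n\ge 0$. Number the rows of the quarter plane $\mathbb Z_{>0}\times\mathbb Z_{>0}$ from top to bottom and the columns from left to right; box $(r,c)$ is in row $r$ and column $c$. A pipe dream is a finite subset $D\subset\mathbb Z_{>0}\times\mathbb Z_{>0}$. Tile each box in $D$ by a cross (joining left to right and bottom to top) and every other box by an elbow joint (joining left to top and bottom to right). This gives a network of pipes, one entering from the left in each row $k\ge 1$ and leaving through the top of some column. $D$ is reduced if every two distinct pipes cross at most once. For $w\in S_n$, extended by $w(k)=k$ for $k>n$, let $\mathcal{RP}(w)$ be the set of reduced pipe dreams in which, for every $k\ge 1$, the pipe entering in row $k$ exits from column $w(k)$. Let $D_0=\{(i,j) : i,j\ge 1,\ i+j\le n\}$. For a pipe dream $D$ and $i\ge 1$ let $\mathrm{start}_i(D)=\min\{j\ge 1 : (i,j)\notin D\}$ and $\mathcal J_i(D)=\{j : 1\le j<\mathrm{start}_i(D),\ (i+1,j)\notin D\}$. For $p\in\mathcal J_i(D)$ let $D_p$ be obtained from $D$ by deleting $(i,p)$ and replacing $(i,q)$ by $(i+1,q)$ for every $q\in\mathcal J_i(D)$ with $q<p$. Put $\mathrm{mitosis}_i(D)=\{D_p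 : p\in\mathcal J_i(D)\}$, and $\mathrm{mitosis}_i(\mathcal P)=\bigcup_{D\in\mathcal P}\mathrm{mitosis}_i(D)$ for a set $\mathcal P$ of pipe dreams. Let $s_i\in S_n$ ($1\le i\le n-1$) be the transposition of $i$ and $i+1$, let $w_0\in S_n$ be given by $w_0(k)=n+1-k$, and let $\mathrm{length}(w)$ be the number of inversions of $w$. Products of permutations are composed as functions, so $(ws_i)(k)=w(s_i(k))$. **Theorem 4.1.** Let $w\in S_n$. 1. If $1\le i\le n-1$ and $\mathrm{length}(ws_i)<\mathrm{length}(w)$, then $\mathcal{RP}(ws_i)=\bigcup_{D\in\mathcal{RP}(w)}\mathrm{mitosis}_i(D)$, and this union is disjoint: $\mathrm{mitosis}_i(D)\cap\mathrm{mitosis}_i(D')=\varnothing$ for distinct $D,D'\in\mathcal{RP}(w)$. 2. If $s_{i_1}\cdots s_{i_k}$ is a reduced expression for $w_0w$ (that is, $w_0w=s_{i_1}\cdots s_{i_k}$ with $k\ge 0$ as small as possible), then $\mathcal{RP}(w)=\mathrm{mitosis}_{i_k}\cdots\mathrm{mitosis}_{i_1}(\{D_0\})$, where $\mathrm{mitosis}_{i_1}$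 is applied first. -/

import Mathlib

namespace PipeDreams

/-- The side through which a pipe enters a box. -/
inductive Side where
  | left
  | bottom

/-- `Enters D k r c s`: in the tiling of the quarter plane (rows numbered `1, 2, …` from the top,
columns numbered `1, 2, …` from the left) with crosses at the boxes of `D` and elbow joints
elsewhere, the pipe that enters the grid from the left in row `k` enters the box `(r, c)` through
its side `s`. A cross joins left to right and bottom to top; an elbow joint joins left to top and
bottom to right. Leaving the grid through the top of the box `(1, c)` is recorded as
`Enters D k 0 c Side.bottom`. -/
inductive Enters (D : Finset (ℕ × ℕ)) (k : ℕ) : ℕ → ℕ → Side → Prop where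
  | start : Enters D k k 1 Side.left
  | cross_left {r c : ℕ} : Enters D k (r + 1) c Side.left → (r + 1, c) ∈ D →
      Enters D k (r + 1) (c + 1) Side.left
  | cross_bottom {r c : ℕ} : Enters D k (r + 1) c Side.bottom → (r + 1, c) ∈ D →
      Enters D k r c Side.bottom
  | elbow_left {r c : ℕ} : Enters D k (r + 1) c Side.left → (r + 1, c) ∉ D →
      Enters D k r c Side.bottom
  | elbow_bottom {r c : ℕ} : Enters D k (r + 1) c Side.bottom → (r + 1, c) ∉ D →
      Enters D k (r + 1) (c + 1) Side.left

/-- The pipe entering in row `k` leaves the grid through the top of column `c`. -/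
def Exits (D : Finset (ℕ × ℕ)) (k c : ℕ) : Prop :=
  Enters D k 0 c Side.bottom

/-- A pipe dream is a finite set of pairs of positive integers. -/
def IsPipeDream (D : Finset (ℕ × ℕ)) : Prop :=
  ∀ b ∈ D, 1 ≤ b.1 ∧ 1 ≤ b.2

/-- The pipes entering in rows `k` and `l` cross each other at the box `b`. -/
def CrossAt (D : Finset (ℕ × ℕ)) (k l : ℕ) (b : ℕ × ℕ) : Prop :=
  b ∈ D ∧
    ((Enters D k b.1 b.2 Side.left ∧ Enters D l b.1 b.2 Side.bottom) ∨
      (Enters D l b.1 b.2 Side.left ∧ Enters D k b.1 b.2 Side.bottom))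

/-- Each pair of pipes crosses at most once. -/
def IsReduced (D : Finset (ℕ × ℕ)) : Prop :=
  ∀ k l : ℕ, 1 ≤ k → 1 ≤ l → k ≠ l →
    ∀ b b' : ℕ × ℕ, CrossAt D k l b → CrossAt D k l b' → b = b'

/-- The reduced pipe dreams for `w ∈ S_n`. Elements of `Fin n` are numbered from `0`, rows and
columns from `1`; as usual `w` is extended to all positive integers by fixing those above `n`. -/
def RP {n : ℕ} (w : Equiv.Perm (Fin n)) : Set (Finset (ℕ × ℕ)) :=
  {D | IsPipeDream D ∧ IsReduced D ∧
    (∀ i : Fin n, Exits D ((i : ℕ) + 1) ((w i : ℕ) + 1)) ∧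
    ∀ k : ℕ, n < k → Exits D k k}

/-- The pipe dream with crosses at all `(i, j)` with `i, j ≥ 1` and `i + j ≤ n`. -/
def D₀ (n : ℕ) : Finset (ℕ × ℕ) :=
  (Finset.Icc 1 n ×ˢ Finset.Icc 1 n).filter fun b => b.1 + b.2 ≤ n

/-- The column index of the leftmost elbow in row `i`. -/
noncomputable def start (D : Finset (ℕ × ℕ)) (i : ℕ) : ℕ :=
  sInf {j | 1 ≤ j ∧ (i, j) ∉ D}

/-- The columns strictly to the left of `start D i` having no cross in row `i + 1`. -/
noncomputable def J (D : Finset (ℕ × ℕ)) (i : ℕ) : Finset ℕ :=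
  (Finset.Ico 1 (start D i)).filter fun j => (i + 1, j) ∉ D

/-- The offspring `D_p`: delete the cross at `(i, p)`, then move each cross of row `i` in a column
of `J D i` to the left of `p` down to the empty box below it. -/
noncomputable def offspring (D : Finset (ℕ × ℕ)) (i p : ℕ) : Finset (ℕ × ℕ) :=
  (D.erase (i, p) \ ((J D i).filter (· < p)).image fun q => (i, q)) ∪
    ((J D i).filter (· < p)).image fun q => (i + 1, q)

/-- The mitosis operator in row `i` on a single pipe dream. -/
def mitosis (i : ℕ) (D : Finset (ℕ × ℕ)) : Set (Finset (ℕ × ℕ)) :=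
  {E | ∃ p ∈ J D i, E = offspring D i p}

/-- The mitosis operator in row `i` on a set of pipe dreams. -/
def mitosisSet (i : ℕ) (P : Set (Finset (ℕ × ℕ))) : Set (Finset (ℕ × ℕ)) :=
  ⋃ D ∈ P, mitosis i D

/-- The adjacent transposition which, numbering from `1`, exchanges `i + 1` and `i + 2`; here
`i = 0, …, n - 2`. -/
def simple {n : ℕ} (i : Fin (n - 1)) : Equiv.Perm (Fin n) :=
  Equiv.swap ⟨i, by omega⟩ ⟨(i : ℕ) + 1, by omega⟩

/-- The number of inversions. -/
def length {n : ℕ} (w : Equiv.Perm (Fin n)) : ℕ :=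
  (Finset.univ.filter fun b : Fin n × Fin n => b.1 < b.2 ∧ w b.2 < w b.1).card

/-- The long permutation `n … 3 2 1`. -/
def w₀ (n : ℕ) : Equiv.Perm (Fin n) := Fin.revPerm

/-- The word `l` is a reduced expression for `v`: the product of its adjacent transpositions is `v`,
and no shorter word has this property. -/
def IsReducedExpression {n : ℕ} (l : List (Fin (n - 1))) (v : Equiv.Perm (Fin n)) : Prop :=
  (l.map simple).prod = v ∧
    ∀ l' : List (Fin (n - 1)), (l'.map simple).prod = v → l.length ≤ l'.length

end PipeDreams

/-! For a pipe dream with permutation `w`, every inversion of `w` forces the two pipes to cross, and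
a box carries only one pair of pipes. Hence being reduced amounts to having exactly `length w`
crosses (`HasPerm.isReduced_iff`), and only exit columns and numbers of crosses need to be followed.

The relation `IsOffspring D E i p` describes one mitosis step without reference to `J`, so it can be
read in both directions. Tracing pipes shows that `D` and `E` have the same exits up to exchanging
pipes `i` and `i + 1` (`IsOffspring.enters_aux`). One cross is lost (`card_offspring`), as is one
inversion, so offspring of reduced pipe dreams are reduced. Conversely, if pipes `i` and `i + 1` do
not cross in a reduced `E`, the leftmost elbow of row `i + 1` lies below an elbow, which allows the
step to be undone (`exists_isOffspring`). The parent is recovered from `E` alone, whence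
disjointness (`IsOffspring.left_unique`).

For the second claim, `RP (w₀ n) = {D₀ n}` starts an induction along the reduced word: each letter
that lengthens a prefix `u` shortens `w₀ n * u`. -/

namespace PipeDreams

/-! ### Pipes along diagonals, and when two pipes cross -/

/-- One step of a pipe through a box. -/
inductive Step (D : Finset (ℕ × ℕ)) : ℕ → ℕ → Side → ℕ → ℕ → Side → Prop where
  | cross_left (r c : ℕ) : (r + 1, c) ∈ D → Step D (r + 1) c Side.left (r + 1) (c + 1) Side.left
  | cross_bottom (r c : ℕ) : (r + 1, c) ∈ D → Step D (r + 1) c Side.bottom r c Side.bottom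
  | elbow_left (r c : ℕ) : (r + 1, c) ∉ D → Step D (r + 1) c Side.left r c Side.bottom
  | elbow_bottom (r c : ℕ) : (r + 1, c) ∉ D →
      Step D (r + 1) c Side.bottom (r + 1) (c + 1) Side.left

/-- The index of a position along its diagonal. -/
def rank (r : ℕ) : Side → ℕ
  | Side.left => 2 * r
  | Side.bottom => 2 * r + 1

variable {D E : Finset (ℕ × ℕ)} {k l r c r' c' : ℕ} {s s' : Side}

theorem Enters.start_or_step (h : Enters D k r c s) :
    (r = k ∧ c = 1 ∧ s = Side.left) ∨
      ∃ r₀ c₀ s₀, Enters D k r₀ c₀ s₀ ∧ Step D r₀ c₀ s₀ r c s := by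
  cases h with
  | start => exact Or.inl ⟨rfl, rfl, rfl⟩
  | cross_left h hb => exact Or.inr ⟨_, _, _, h, .cross_left _ _ hb⟩
  | cross_bottom h hb => exact Or.inr ⟨_, _, _, h, .cross_bottom _ _ hb⟩
  | elbow_left h hb => exact Or.inr ⟨_, _, _, h, .elbow_left _ _ hb⟩
  | elbow_bottom h hb => exact Or.inr ⟨_, _, _, h, .elbow_bottom _ _ hb⟩

theorem Enters.step_induction {P : ℕ → ℕ → Side → Prop} (h0 : P k 1 Side.left)
    (hstep : ∀ r c s r' c' s', Enters D k r c s → Step D r c s r' c' s' → P r c s → P r' c' s')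
    (h : Enters D k r c s) : P r c s := by
  induction h with
  | start => exact h0
  | cross_left h hb ih => exact hstep _ _ _ _ _ _ h (.cross_left _ _ hb) ih
  | cross_bottom h hb ih => exact hstep _ _ _ _ _ _ h (.cross_bottom _ _ hb) ih
  | elbow_left h hb ih => exact hstep _ _ _ _ _ _ h (.elbow_left _ _ hb) ih
  | elbow_bottom h hb ih => exact hstep _ _ _ _ _ _ h (.elbow_bottom _ _ hb) ih

/-- Each step raises column minus row by one, so this difference serves as the time parameter at
which different pipes are compared. -/
theorem Step.diag (h : Step D r c s r' c' s') : c' + r = c + r' + 1 := by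
  cases h <;> omega

theorem Step.row_pos (h : Step D r c s r' c' s') : 1 ≤ r := by
  cases h <;> omega

theorem Step.col_le (h : Step D r c s r' c' s') : c ≤ c' := by
  cases h <;> omega

theorem Step.det {r'' c'' : ℕ} {s'' : Side} (h : Step D r c s r' c' s')
    (h' : Step D r c s r'' c'' s'') : r' = r'' ∧ c' = c'' ∧ s' = s'' := by
  cases h <;> cases h' <;> simp_all

theorem Step.inj {r₁ c₁ r₂ c₂ : ℕ} {s₁ s₂ : Side} (h : Step D r₁ c₁ s₁ r c s)
    (h' : Step D r₂ c₂ s₂ r c s) : r₁ = r₂ ∧ c₁ = c₂ ∧ s₁ = s₂ := by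
  cases h <;> cases h' <;> simp_all

/-- Along a diagonal, a step preserves the order of two pipes unless they cross. -/
theorem Step.rank_lt {r₁ c₁ r₂ c₂ r₁' c₁' r₂' c₂' : ℕ} {s₁ s₂ s₁' s₂' : Side}
    (h₁ : Step D r₁ c₁ s₁ r₁' c₁' s₁') (h₂ : Step D r₂ c₂ s₂ r₂' c₂' s₂')
    (hd : r₂ + c₁ = r₁ + c₂) (hr : rank r₁ s₁ < rank r₂ s₂) :
    rank r₁' s₁' < rank r₂' s₂' ∨
      (r₁ = r₂ ∧ c₁ = c₂ ∧ s₁ = Side.left ∧ s₂ = Side.bottom ∧ (r₁, c₁) ∈ D ∧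
        rank r₂' s₂' < rank r₁' s₁') := by
  by_cases e : r₁ = r₂
  · subst e
    obtain rfl : c₁ = c₂ := by omega
    cases h₁ <;> cases h₂ <;> simp_all [rank] <;> omega
  · left
    cases h₁ <;> cases h₂ <;> simp only [rank] at * <;> omega

theorem Enters.col_pos (h : Enters D k r c s) : 1 ≤ c := by
  refine h.step_induction (P := fun _ c _ => 1 ≤ c) le_rfl ?_
  intro r c s r' c' s' _ hs hc
  exact hc.trans hs.col_le

theorem Enters.diag_le (h : Enters D k r c s) : r + 1 ≤ k + c := by
  refine h.step_induction (P := fun r c _ => r + 1 ≤ k + c) le_rfl ?_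
  intro r c s r' c' s' _ hs hc
  have := hs.diag
  omega

theorem Enters.pipe_unique (hk : Enters D k r c s) (hl : Enters D l r c s) : k = l := by
  refine hk.step_induction (P := fun r c s => Enters D l r c s → k = l) ?_ ?_ hl
  · intro h
    rcases h.start_or_step with ⟨h, -⟩ | ⟨r₀, c₀, s₀, h, hs⟩
    · exact h
    · have := h.col_pos
      cases hs <;> omega
  · intro r c s r' c' s' hk hs ih h
    rcases h.start_or_step with ⟨rfl, rfl, rfl⟩ | ⟨r₀, c₀, s₀, h, hs'⟩
    · have := hk.col_pos
      cases hs <;> omega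
    · obtain ⟨rfl, rfl, rfl⟩ := hs.inj hs'
      exact ih h

theorem Enters.pos_unique (h : Enters D k r c s) (h' : Enters D k r' c' s')
    (hd : r' + c = r + c') : r = r' ∧ c = c' ∧ s = s' := by
  refine h.step_induction (P := fun r c s => ∀ r' c' s', Enters D k r' c' s' →
    r' + c = r + c' → r = r' ∧ c = c' ∧ s = s') ?_ ?_ _ _ _ h' hd
  · intro r' c' s' h hd
    rcases h.start_or_step with ⟨rfl, rfl, rfl⟩ | ⟨r₀, c₀, s₀, h, hs⟩
    · simp
    · have := h.diag_le
      have := hs.diag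
      omega
  · intro r c s r₁ c₁ s₁ hk hs ih r' c' s' h hd
    have := hs.diag
    have := hk.diag_le
    rcases h.start_or_step with ⟨rfl, rfl, rfl⟩ | ⟨r₀, c₀, s₀, h, hs'⟩
    · omega
    · have := hs'.diag
      obtain ⟨rfl, rfl, rfl⟩ := ih _ _ _ h (by omega)
      exact hs.det hs'

theorem CrossAt.ne {b : ℕ × ℕ} (h : CrossAt D k l b) : k ≠ l := by
  rintro rfl
  obtain ⟨-, ⟨h, h'⟩ | ⟨h, h'⟩⟩ := h
  all_goals
    have := (h.pos_unique h' rfl).2.2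
    cases this

/-- Every position is entered by some pipe. -/
theorem exists_enters (D : Finset (ℕ × ℕ)) : ∀ (r c : ℕ) (s : Side), 1 ≤ c →
    (s = Side.left → 1 ≤ r) → ∃ k, 1 ≤ k ∧ Enters D k r c s := by
  obtain ⟨N, hN⟩ : ∃ N, ∀ b ∈ D, b.1 ≤ N :=
    ⟨D.sup Prod.fst, fun b hb => Finset.le_sup (f := Prod.fst) hb⟩
  -- The pipe is traced backwards. Going left lowers `2 * c` by more than the change of side can
  -- add; going down through a cross lowers `N - r`, as `N` bounds the rows of `D`; going down
  -- through an elbow turns `bottom` into `left`.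
  have key : ∀ m r c : ℕ, ∀ s : Side, 2 * c + (N - r) + rank 0 s ≤ m → 1 ≤ c →
      (s = Side.left → 1 ≤ r) → ∃ k, 1 ≤ k ∧ Enters D k r c s := by
    intro m
    induction m with
    | zero => intro r c s h hc; omega
    | succ m ih =>
      intro r c s h hc hr
      cases s with
      | left =>
        obtain ⟨r, rfl⟩ : ∃ r₀, r = r₀ + 1 := ⟨r - 1, by have := hr rfl; omega⟩
        rcases Nat.lt_or_ge 1 c with h1 | h1
        · obtain ⟨c, rfl⟩ : ∃ c₀, c = c₀ + 1 := ⟨c - 1, by omega⟩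
          by_cases hb : (r + 1, c) ∈ D
          · obtain ⟨k, hk, h⟩ := ih (r + 1) c Side.left
              (by simp only [rank] at *; omega) (by omega) (by simp)
            exact ⟨k, hk, h.cross_left hb⟩
          · obtain ⟨k, hk, h⟩ := ih (r + 1) c Side.bottom
              (by simp only [rank] at *; omega) (by omega) (by simp)
            exact ⟨k, hk, h.elbow_bottom hb⟩
        · obtain rfl : c = 1 := by omega
          exact ⟨r + 1, by omega, .start⟩
      | bottom =>
        by_cases hb : (r + 1, c) ∈ D
        · have := hN _ hb
          obtain ⟨k, hk, h⟩ := ih (r + 1) c Side.bottom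
              (by simp only [rank] at *; omega) (by omega) (by simp)
          exact ⟨k, hk, h.cross_bottom hb⟩
        · obtain ⟨k, hk, h⟩ := ih (r + 1) c Side.left
              (by simp only [rank] at *; omega) (by omega) (by simp)
          exact ⟨k, hk, h.elbow_left hb⟩
  intro r c s
  exact key _ r c s le_rfl

/-- Before their first crossing, two pipes are ordered as their starting rows. -/
theorem rank_lt_of_not_crossAt (hkl : k < l) (hk : Enters D k r c s) (hl : Enters D l r' c' s')
    (hd : r' + c = r + c') (hx : ∀ b, CrossAt D k l b → c + b.1 ≤ b.2 + r) :
    rank r s < rank r' s' := by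
  refine hk.step_induction (P := fun r c s => ∀ r' c' s', Enters D l r' c' s' →
    r' + c = r + c' → (∀ b, CrossAt D k l b → c + b.1 ≤ b.2 + r) → rank r s < rank r' s')
    ?_ ?_ _ _ _ hl hd hx
  · intro r' c' s' h hd _
    have := h.col_pos
    rcases Nat.lt_or_ge k r' with h1 | h1
    · cases s' <;> simp only [rank] <;> omega
    · obtain rfl : r' = k := by omega
      obtain rfl : c' = 1 := by omega
      cases s' with
      | left => exact absurd (h.pipe_unique .start) hkl.ne'
      | bottom => simp [rank]
  · intro r₀ c₀ s₀ r c s hk hs ih r' c' s' h hd hx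
    have := hs.diag
    have := hk.diag_le
    rcases h.start_or_step with ⟨rfl, rfl, rfl⟩ | ⟨r₁, c₁, s₁, h, hs'⟩
    · omega
    · have := hs'.diag
      have h1 := ih _ _ _ h (by omega) (fun b hb => by have := hx b hb; omega)
      rcases hs.rank_lt hs' (by omega) h1 with h2 | ⟨rfl, rfl, rfl, rfl, hb, -⟩
      · exact h2
      · have := hx (r₀, c₀) ⟨hb, Or.inl ⟨hk, h⟩⟩
        simp only at this
        omega

/-- After their only crossing, two pipes are in the order opposite to that of their starting
rows. -/
theorem rank_lt_of_crossAt {b : ℕ × ℕ} (hkl : k < l) (hb : CrossAt D k l b)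
    (hu : ∀ b', CrossAt D k l b' → b' = b)
    (hk : Enters D k r c s) (hl : Enters D l r' c' s')
    (hd : r' + c = r + c') (hlt : b.2 + r < c + b.1) : rank r' s' < rank r s := by
  have hkb : ∃ s, Enters D k b.1 b.2 s := by
    obtain ⟨-, ⟨h, -⟩ | ⟨-, h⟩⟩ := hb <;> exact ⟨_, h⟩
  have hlb : ∃ s, Enters D l b.1 b.2 s := by
    obtain ⟨-, ⟨-, h⟩ | ⟨h, -⟩⟩ := hb <;> exact ⟨_, h⟩
  refine hk.step_induction (P := fun r c s => ∀ r' c' s', Enters D l r' c' s' →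
    r' + c = r + c' → b.2 + r < c + b.1 → rank r' s' < rank r s) ?_ ?_ _ _ _ hl hd hlt
  · intro r' c' s' h hd hlt
    obtain ⟨s, hs⟩ := hkb
    have := hs.diag_le
    omega
  · intro r₀ c₀ s₀ r c s hk hs ih r' c' s' h hd hlt
    have := hs.diag
    rcases h.start_or_step with ⟨rfl, rfl, rfl⟩ | ⟨r₁, c₁, s₁, h, hs'⟩
    · obtain ⟨s, hs⟩ := hlb
      have := hs.diag_le
      omega
    · have := hs'.diag
      rcases Nat.lt_or_ge (b.2 + r₀) (c₀ + b.1) with h1 | h1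
      · have h2 := ih _ _ _ h (by omega) h1
        rcases hs'.rank_lt hs (by omega) h2 with h3 | ⟨rfl, rfl, rfl, rfl, hb', -⟩
        · exact h3
        · have := hu _ ⟨hb', Or.inr ⟨h, hk⟩⟩
          subst this
          simp only at h1
          omega
      -- Here the preceding diagonal is that of `b`, so the step at hand is the crossing itself.
      · have h2 := rank_lt_of_not_crossAt hkl hk h (by omega)
          (fun b' hb' => by rw [hu _ hb']; omega)
        obtain ⟨s₂, hs₂⟩ := hkb
        obtain ⟨s₃, hs₃⟩ := hlb
        obtain ⟨e1, e2, -⟩ := hk.pos_unique hs₂ (by omega)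
        obtain ⟨e3, e4, -⟩ := h.pos_unique hs₃ (by omega)
        rcases hs.rank_lt hs' (by omega) h2 with h3 | ⟨-, -, -, -, -, h3⟩
        · exfalso
          have hbD := hb.1
          obtain ⟨b1, b2⟩ := b
          simp only at e1 e2 e3 e4
          subst e1 e2
          subst e3 e4
          cases hs <;> cases hs' <;> simp_all [rank]
        · exact h3

theorem Enters.exists_row_pos_of_lt (hk : 1 ≤ k) (h : Enters D k r c s) {d : ℕ} (hd : 1 ≤ d)
    (hlt : d + r < c) :
    ∃ r' c' s', Enters D k r' c' s' ∧ c' = r' + d ∧ 1 ≤ r' := by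
  refine h.step_induction (P := fun r c _ => d + r < c →
    ∃ r' c' s', Enters D k r' c' s' ∧ c' = r' + d ∧ 1 ≤ r') (by omega) ?_ hlt
  intro r c s r' c' s' h hs ih hlt
  have := hs.diag
  have := hs.row_pos
  rcases Nat.lt_or_ge (d + r) c with h1 | h1
  · exact ih h1
  · exact ⟨r, c, s, h, by omega, hs.row_pos⟩

/-- On the diagonal where pipe `l` exits, pipe `k` is still in a positive row, hence has larger
rank; without a crossing its rank would be smaller. -/
theorem exists_crossAt_of_exits {x y : ℕ} (hk0 : 1 ≤ k) (hkl : k < l) (hk : Exits D k x)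
    (hl : Exits D l y) (hyx : y < x) : ∃ b, CrossAt D k l b := by
  by_contra! hx
  have hy := Enters.col_pos hl
  obtain ⟨r, c, s, h, rfl, hr⟩ := Enters.exists_row_pos_of_lt hk0 hk hy (by omega)
  have := rank_lt_of_not_crossAt hkl h hl (by omega) (fun b hb => absurd hb (hx b))
  cases s <;> simp only [rank] at this <;> omega

theorem Enters.diag_le_of_exits (hk : 1 ≤ k) {x : ℕ} (hx : Exits D k x) (h : Enters D k r c s) :
    c ≤ r + x := by
  by_contra! hlt
  have hx1 := Enters.col_pos hx
  obtain ⟨r', c', s', h', rfl, hr'⟩ := h.exists_row_pos_of_lt hk hx1 (by omega)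
  have := (h'.pos_unique hx (by omega)).1
  omega

theorem exits_lt_of_crossAt {b : ℕ × ℕ} {x y : ℕ} (hk0 : 1 ≤ k) (hkl : k < l)
    (hb : CrossAt D k l b) (hu : ∀ b', CrossAt D k l b' → b' = b)
    (hk : Exits D k x) (hl : Exits D l y) : y < x := by
  by_contra! hxy
  have hx := Enters.col_pos hk
  have hbx : b.2 < b.1 + x := by
    have hk' : ∃ s, Enters D k b.1 b.2 s := by
      obtain ⟨-, ⟨h, -⟩ | ⟨-, h⟩⟩ := hb <;> exact ⟨_, h⟩
    obtain ⟨s, hs⟩ := hk'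
    have h1 := hs.diag_le_of_exits hk0 hk
    refine lt_of_le_of_ne h1 fun e => ?_
    obtain ⟨e1, e2, -⟩ := hs.pos_unique hk (by omega)
    have hl' : ∃ s, Enters D l b.1 b.2 s := by
      obtain ⟨-, ⟨-, h⟩ | ⟨h, -⟩⟩ := hb <;> exact ⟨_, h⟩
    -- `D` may contain boxes of row `0` here; a crossing in such a box would need a pipe entering
    -- row `0` from the left, which only pipe `0` does.
    have : ∀ k, ¬ Enters D k 0 b.2 Side.left ∨ k = 0 := by
      intro k
      by_cases hk : k = 0
      · exact Or.inr hk
      · left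
        intro h
        rcases h.start_or_step with ⟨rfl, -⟩ | ⟨r₀, c₀, s₀, h, hs⟩
        · exact hk rfl
        · cases hs
    obtain ⟨-, ⟨h, -⟩ | ⟨h, -⟩⟩ := hb <;> rw [e1] at h
    · rcases this k with h' | h'
      · exact h' h
      · omega
    · rcases this l with h' | h'
      · exact h' h
      · omega
  rcases hxy.lt_or_eq with h | rfl
  · obtain ⟨r, c, s, h, rfl, hr⟩ := Enters.exists_row_pos_of_lt (by omega) hl hx (by omega)
    have := rank_lt_of_crossAt hkl hb hu hk h (by omega) (by omega)
    cases s <;> simp only [rank] at this <;> omega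
  · exact hkl.ne (Enters.pipe_unique hk hl)

theorem CrossAt.symm {b : ℕ × ℕ} (h : CrossAt D k l b) : CrossAt D l k b :=
  ⟨h.1, h.2.symm⟩

theorem CrossAt.pair_eq {b : ℕ × ℕ} {k' l' : ℕ} (h : CrossAt D k l b) (h' : CrossAt D k' l' b) :
    (k = k' ∧ l = l') ∨ (k = l' ∧ l = k') := by
  obtain ⟨-, ⟨h1, h2⟩ | ⟨h1, h2⟩⟩ := h <;> obtain ⟨-, ⟨h3, h4⟩ | ⟨h3, h4⟩⟩ := h'
  · exact Or.inl ⟨h1.pipe_unique h3, h2.pipe_unique h4⟩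
  · exact Or.inr ⟨h1.pipe_unique h3, h2.pipe_unique h4⟩
  · exact Or.inr ⟨h2.pipe_unique h4, h1.pipe_unique h3⟩
  · exact Or.inl ⟨h2.pipe_unique h4, h1.pipe_unique h3⟩

theorem IsPipeDream.exists_crossAt (hD : IsPipeDream D) {b : ℕ × ℕ} (hb : b ∈ D) :
    ∃ k l, 1 ≤ k ∧ k < l ∧ CrossAt D k l b := by
  obtain ⟨h1, h2⟩ := hD b hb
  obtain ⟨k, hk, hkb⟩ := exists_enters D b.1 b.2 Side.left h2 (fun _ => h1)
  obtain ⟨l, hl, hlb⟩ := exists_enters D b.1 b.2 Side.bottom h2 (by simp)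
  have hx : CrossAt D k l b := ⟨hb, Or.inl ⟨hkb, hlb⟩⟩
  rcases hx.ne.lt_or_gt with h | h
  · exact ⟨k, l, hk, h, hx⟩
  · exact ⟨l, k, hl, h, hx.symm⟩

end PipeDreams

/-! ### The permutation of a pipe dream, and reducedness by counting crosses -/

namespace PipeDreams

variable {D E : Finset (ℕ × ℕ)} {k l r c r' c' : ℕ} {s s' : Side} {n : ℕ}
  {w : Equiv.Perm (Fin n)}

/-- Every pipe leaves through the column prescribed by `w`. -/
def HasPerm (D : Finset (ℕ × ℕ)) (w : Equiv.Perm (Fin n)) : Prop :=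
  (∀ i : Fin n, Exits D ((i : ℕ) + 1) ((w i : ℕ) + 1)) ∧ ∀ k : ℕ, n < k → Exits D k k

theorem mem_RP : D ∈ RP w ↔ IsPipeDream D ∧ IsReduced D ∧ HasPerm D w := Iff.rfl

theorem HasPerm.inverted_of_crossAt (h : HasPerm D w) (hr : IsReduced D) (hk : 1 ≤ k)
    (hkl : k < l) {b : ℕ × ℕ} (hb : CrossAt D k l b) :
    ∃ i j : Fin n, i < j ∧ w j < w i ∧ k = i + 1 ∧ l = j + 1 := by
  have hu : ∀ b', CrossAt D k l b' → b' = b :=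
    fun b' hb' => hr k l hk (by omega) hkl.ne b' b hb' hb
  have key : ∀ {x y}, Exits D k x → Exits D l y → y < x :=
    fun hx hy => exits_lt_of_crossAt hk hkl hb hu hx hy
  have hk' : ∀ h : k ≤ n, Exits D k (w ⟨k - 1, by omega⟩ + 1) := by
    intro hkn
    have := h.1 ⟨k - 1, by omega⟩
    rwa [Nat.sub_add_cancel hk] at this
  rcases Nat.lt_or_ge n l with hl | hl
  · exfalso
    have h2 := h.2 l hl
    rcases Nat.lt_or_ge n k with hkn | hkn
    · have := key (h.2 k hkn) h2
      omega
    · have := key (hk' hkn) h2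
      omega
  · have h2 := h.1 ⟨l - 1, by omega⟩
    rw [Nat.sub_add_cancel (by omega)] at h2
    have := key (hk' (by omega)) h2
    exact ⟨⟨k - 1, by omega⟩, ⟨l - 1, by omega⟩, Fin.mk_lt_mk.2 (by omega),
      Fin.lt_def.2 (by omega), by simp; omega, by simp; omega⟩

/-- Choosing a crossing for each inversion injects the inversions into `D`. If `D` is reduced, every
cross comes from an inversion; if the numbers agree, the injection is onto, and no pair can own two
boxes. -/
theorem HasPerm.isReduced_iff (hD : IsPipeDream D) (h : HasPerm D w) :
    IsReduced D ↔ D.card = length w := by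
  have hex : ∀ p ∈ Finset.univ.filter fun b : Fin n × Fin n => b.1 < b.2 ∧ w b.2 < w b.1,
      ∃ b, CrossAt D (p.1 + 1) (p.2 + 1) b := by
    intro p hp
    simp only [Finset.mem_filter, Finset.mem_univ, true_and, Fin.lt_def] at hp
    exact exists_crossAt_of_exits (by omega) (by omega) (h.1 p.1) (h.1 p.2) (by omega)
  choose g hg using hex
  have hinj : ∀ p hp q hq, g p hp = g q hq → p = q := by
    intro p hp q hq e
    have h1 := hg p hp
    have h2 := hg q hq
    rw [e] at h1
    simp only [Finset.mem_filter, Finset.mem_univ, true_and, Fin.lt_def] at hp hq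
    have := h1.pair_eq h2
    ext <;> omega
  have hmem : ∀ p hp, g p hp ∈ D := fun p hp => (hg p hp).1
  constructor
  · intro hr
    refine (Finset.card_bij g hmem hinj ?_).symm
    intro b hb
    obtain ⟨k, l, hk, hkl, hx⟩ := hD.exists_crossAt hb
    obtain ⟨i, j, hij, hw, rfl, rfl⟩ := h.inverted_of_crossAt hr hk hkl hx
    refine ⟨(i, j), by simp [hij, hw], ?_⟩
    exact hr _ _ hk (by omega) hkl.ne _ _ (hg _ _) hx
  · intro hc
    have hsurj := Finset.surj_on_of_inj_on_of_card_le g hmem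
      (fun p q hp hq e => hinj p hp q hq e) hc.le
    intro k l hk hl hkl b b' hb hb'
    obtain ⟨p, hp, rfl⟩ := hsurj b hb.1
    obtain ⟨q, hq, rfl⟩ := hsurj b' hb'.1
    have h1 := hb.pair_eq (hg p hp)
    have h2 := hb'.pair_eq (hg q hq)
    have e : p = q := by
      simp only [Finset.mem_filter, Finset.mem_univ, true_and, Fin.lt_def] at hp hq
      ext <;> omega
    subst e
    rfl

/-! ### How a mitosis step changes the pipes -/

/-- `E` arises from `D` by removing the box `(i, p)` and moving crosses down from row `i` to row
`i + 1` in the columns to the left of `p`, in the way of a mitosis offspring. -/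
structure IsOffspring (D E : Finset (ℕ × ℕ)) (i p : ℕ) : Prop where
  row_pos : 1 ≤ i
  col_pos : 1 ≤ p
  top_mem : ∀ c, 1 ≤ c → c ≤ p → (i, c) ∈ D
  top_iff : ∀ c, 1 ≤ c → c < p → ((i, c) ∈ E ↔ (i + 1, c) ∈ D)
  bot_mem : ∀ c, 1 ≤ c → c < p → (i + 1, c) ∈ E
  top_notMem : (i, p) ∉ E
  bot_notMem : (i + 1, p) ∉ E
  bot_notMem' : (i + 1, p) ∉ D
  other : ∀ r c, 1 ≤ c → ((r ≠ i ∧ r ≠ i + 1) ∨ p < c) → ((r, c) ∈ E ↔ (r, c) ∈ D)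

variable {i p : ℕ}

theorem Enters.left_of_forall_mem (hi : 1 ≤ i) (h : ∀ c', 1 ≤ c' → c' < c → (i, c') ∈ D)
    (hc : 1 ≤ c) : Enters D i i c Side.left := by
  obtain ⟨i, rfl⟩ : ∃ j, i = j + 1 := ⟨i - 1, by omega⟩
  induction c, hc using Nat.le_induction with
  | base => exact .start
  | succ c hc ih => exact (ih fun c' h1 h2 => h c' h1 (by omega)).cross_left (h c hc (by omega))

/-- To the left of column `p`, row `i` of `E` copies row `i + 1` of `D`, while the full rows, `i +
1` in `E` and `i` in `D`, are passed vertically. The pipe running along the full row is `i + 1` in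
`E` and `i` in `D`; at column `p` of `E` two elbows lift it to row `i`, where both continue from
column `p + 1`. The last clause covers all positions outside this strip. -/
theorem IsOffspring.enters_aux (h : IsOffspring D E i p) (hk : Enters E k r c s) :
    (c ≤ p → r = i → s = Side.left → Enters D (Equiv.swap i (i + 1) k) (i + 1) c Side.left) ∧
    (c ≤ p → r = i + 1 → s = Side.left → k = i + 1) ∧
    (c < p → r = i → s = Side.bottom →
      Enters D (Equiv.swap i (i + 1) k) (i + 1) c Side.bottom) ∧
    (c = p → r = i → s = Side.bottom → k = i + 1) ∧
    (p < c ∨ (r ≠ i ∧ r ≠ i + 1) ∨ (r = i + 1 ∧ s = Side.bottom) →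
      Enters D (Equiv.swap i (i + 1) k) r c s) := by
  have hp := h.col_pos
  induction hk with
  | start =>
    refine ⟨?_, fun _ h _ => h, by simp, by simp, ?_⟩
    · rintro - rfl -
      rw [Equiv.swap_apply_left]
      exact .start
    · intro hc
      have : k ≠ i ∧ k ≠ i + 1 := by simpa [Nat.not_lt.2 hp] using hc
      rw [Equiv.swap_apply_of_ne_of_ne this.1 this.2]
      exact .start
  | @cross_left r c hk hb ih =>
    have hc := hk.col_pos
    obtain ⟨i1, i2, -, -, i5⟩ := ih
    refine ⟨?_, ?_, by simp, by simp, ?_⟩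
    · intro hcp hr _
      exact (i1 (by omega) hr rfl).cross_left ((h.top_iff c hc (by omega)).1 (hr ▸ hb))
    · intro hcp hr _
      exact i2 (by omega) hr rfl
    · intro hh
      have h1 : p < c ∨ (r + 1 ≠ i ∧ r + 1 ≠ i + 1) := by
        rcases hh with hh | hh | hh
        · rcases Nat.lt_or_ge p c with h1 | h1
          · exact Or.inl h1
          · obtain rfl : p = c := by omega
            right
            constructor <;> intro e <;> rw [e] at hb
            · exact h.top_notMem hb
            · exact h.bot_notMem hb
        · exact Or.inr hh
        · simp at hh
      exact (i5 (h1.imp_right Or.inl)).cross_left ((h.other _ _ hc h1.symm).1 hb)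
  | @cross_bottom r c hk hb ih =>
    have hc := hk.col_pos
    obtain ⟨-, -, i3, i4, i5⟩ := ih
    refine ⟨by simp, by simp, ?_, ?_, ?_⟩
    · rintro hcp rfl -
      exact i5 (by simp)
    · rintro rfl rfl -
      exact absurd hb h.bot_notMem
    · intro hh
      rcases Nat.lt_or_ge p c with h1 | h1
      · exact (i5 (Or.inl h1)).cross_bottom ((h.other _ _ hc (Or.inr h1)).1 hb)
      · have hri : r ≠ i := by rintro rfl; rcases hh with hh | hh | hh <;> omega
        by_cases e : r + 1 = i
        · subst e
          have h2 : c < p := by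
            refine lt_of_le_of_ne h1 ?_
            rintro rfl
            exact h.top_notMem hb
          exact ((i3 h2 rfl rfl).cross_bottom ((h.top_iff c hc h2).1 hb)).cross_bottom
            (h.top_mem c hc h1)
        · have h2 : r + 1 ≠ i ∧ r + 1 ≠ i + 1 := ⟨e, by omega⟩
          exact (i5 (Or.inr (Or.inl h2))).cross_bottom ((h.other _ _ hc (Or.inl h2)).1 hb)
  | @elbow_left r c hk hb ih =>
    have hc := hk.col_pos
    obtain ⟨i1, i2, -, -, i5⟩ := ih
    refine ⟨by simp, by simp, ?_, ?_, ?_⟩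
    · rintro hcp rfl -
      exact absurd (h.bot_mem c hc hcp) hb
    · rintro rfl rfl -
      exact i2 le_rfl rfl rfl
    · intro hh
      rcases Nat.lt_or_ge p c with h1 | h1
      · exact (i5 (Or.inl h1)).elbow_left (mt (h.other _ _ hc (Or.inr h1)).2 hb)
      · have hri : r ≠ i := by rintro rfl; rcases hh with hh | hh | hh <;> omega
        by_cases e : r + 1 = i
        · subst e
          have h2 : (r + 1 + 1, c) ∉ D := by
            rcases h1.lt_or_eq with h2 | rfl
            · exact mt (h.top_iff c hc h2).2 hb
            · exact h.bot_notMem'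
          exact ((i1 h1 rfl rfl).elbow_left h2).cross_bottom (h.top_mem c hc h1)
        · have h2 : r + 1 ≠ i ∧ r + 1 ≠ i + 1 := ⟨e, by omega⟩
          exact (i5 (Or.inr (Or.inl h2))).elbow_left (mt (h.other _ _ hc (Or.inl h2)).2 hb)
  | @elbow_bottom r c hk hb ih =>
    have hc := hk.col_pos
    obtain ⟨-, -, i3, i4, i5⟩ := ih
    refine ⟨?_, ?_, by simp, by simp, ?_⟩
    · intro hcp hr _
      exact (i3 (by omega) hr rfl).elbow_bottom
        (mt (h.top_iff c hc (by omega)).2 (hr ▸ hb))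
    · intro hcp hr _
      exact absurd (h.bot_mem c hc (by omega)) (hr ▸ hb)
    · intro hh
      rcases Nat.lt_or_ge p c with h1 | h1
      · exact (i5 (Or.inl h1)).elbow_bottom (mt (h.other _ _ hc (Or.inr h1)).2 hb)
      · by_cases e : r + 1 = i
        · have h2 : c = p := by omega
          rw [i4 h2 e rfl, Equiv.swap_apply_right, e]
          refine Enters.left_of_forall_mem h.row_pos (fun c' h3 h4 => h.top_mem c' h3 ?_) ?_ <;>
            omega
        · by_cases e' : r + 1 = i + 1
          · have h2 : c = p := by
              have : ¬ c < p := fun h3 => hb (e' ▸ h.bot_mem c hc h3)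
              omega
            refine (i5 (Or.inr (Or.inr ⟨e', rfl⟩))).elbow_bottom ?_
            rw [e', h2]
            exact h.bot_notMem'
          · exact (i5 (Or.inr (Or.inl ⟨e, e'⟩))).elbow_bottom (mt (h.other _ _ hc (Or.inl ⟨e, e'⟩)).2 hb)

theorem IsOffspring.exits (h : IsOffspring D E i p) (hk : Exits E k c) :
    Exits D (Equiv.swap i (i + 1) k) c := by
  have := h.row_pos
  exact (h.enters_aux hk).2.2.2.2 (Or.inr (Or.inl (by omega)))

/-- Some pipe of `E` leaves through column `c`; by `IsOffspring.exits` it can only be the exchanged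
one. -/
theorem IsOffspring.exits' (h : IsOffspring D E i p) (hk : Exits D k c) :
    Exits E (Equiv.swap i (i + 1) k) c := by
  obtain ⟨j, -, hj⟩ := exists_enters E 0 c Side.bottom (Enters.col_pos hk) (by simp)
  have := Enters.pipe_unique (h.exits hj) hk
  rw [← this, Equiv.swap_apply_self]
  exact hj

theorem val_simple (i : Fin (n - 1)) (j : Fin n) :
    ((simple i j : Fin n) : ℕ) + 1 = Equiv.swap ((i : ℕ) + 1) (i + 1 + 1) ((j : ℕ) + 1) := by
  simp only [simple, Equiv.swap_apply_def, Fin.ext_iff]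
  split_ifs <;> simp <;> omega

theorem simple_mul_self (i : Fin (n - 1)) : simple i * simple i = 1 :=
  Equiv.swap_mul_self _ _

theorem simple_simple (i : Fin (n - 1)) (j : Fin n) : simple i (simple i j) = j :=
  Equiv.swap_apply_self _ _ _

theorem HasPerm.of_swap {i : Fin (n - 1)} (h : HasPerm D w)
    (hDE : ∀ k c, Exits D k c → Exits E (Equiv.swap ((i : ℕ) + 1) (i + 1 + 1) k) c) :
    HasPerm E (w * simple i) := by
  constructor
  · intro j
    have := hDE _ _ (h.1 (simple i j))
    rw [val_simple, Equiv.swap_apply_self] at this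
    exact this
  · intro k hk
    have := hDE _ _ (h.2 k hk)
    rwa [Equiv.swap_apply_of_ne_of_ne (by omega) (by omega)] at this

theorem IsOffspring.hasPerm {i : Fin (n - 1)} (h : IsOffspring D E ((i : ℕ) + 1) p)
    (hD : HasPerm D w) : HasPerm E (w * simple i) :=
  hD.of_swap fun _ _ => h.exits'

theorem IsOffspring.hasPerm' {i : Fin (n - 1)} (h : IsOffspring D E ((i : ℕ) + 1) p)
    (hE : HasPerm E w) : HasPerm D (w * simple i) :=
  hE.of_swap fun _ _ => h.exits

end PipeDreams

/-! ### Offspring and parents determine each other -/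

namespace PipeDreams

variable {D D' E : Finset (ℕ × ℕ)} {k l r c i p p' n : ℕ} {w : Equiv.Perm (Fin n)}

theorem exists_notMem_row (D : Finset (ℕ × ℕ)) (i : ℕ) : ∃ j, 1 ≤ j ∧ (i, j) ∉ D := by
  refine ⟨D.sup Prod.snd + 1, by omega, fun h => ?_⟩
  have := Finset.le_sup (f := Prod.snd) h
  simp only at this
  omega

theorem mem_J : p ∈ J D i ↔
    1 ≤ p ∧ (∀ c, 1 ≤ c → c ≤ p → (i, c) ∈ D) ∧ (i + 1, p) ∉ D := by
  simp only [J, Finset.mem_filter, Finset.mem_Ico, and_assoc]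
  refine and_congr_right fun _ => and_congr_left fun _ => ⟨fun h c h1 h2 => ?_, fun h => ?_⟩
  · by_contra hc
    have : start D i ≤ c := Nat.sInf_le ⟨h1, hc⟩
    omega
  · by_contra! hlt
    -- The set is nonempty because `D` is finite, so `start` is not the default value `0`.
    obtain ⟨h1, h2⟩ := Nat.sInf_mem (exists_notMem_row D i)
    exact h2 (h _ h1 hlt)

theorem mem_offspring : (r, c) ∈ offspring D i p ↔
    ((r, c) ∈ D ∧ ¬ (r = i ∧ c = p) ∧ ¬ (r = i ∧ c ∈ J D i ∧ c < p)) ∨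
      (r = i + 1 ∧ c ∈ J D i ∧ c < p) := by
  simp only [offspring, Finset.mem_union, Finset.mem_sdiff, Finset.mem_erase, Finset.mem_image,
    Finset.mem_filter, Prod.mk.injEq, ne_eq]
  constructor
  · rintro (⟨⟨h1, h2⟩, h3⟩ | ⟨q, hq, rfl, rfl⟩)
    · exact Or.inl ⟨h2, h1, fun ⟨h4, h5⟩ => h3 ⟨c, h5, h4.symm, rfl⟩⟩
    · exact Or.inr ⟨rfl, hq⟩
  · rintro (⟨h1, h2, h3⟩ | ⟨rfl, h⟩)
    · exact Or.inl ⟨⟨h2, h1⟩, fun ⟨q, hq, e1, e2⟩ => h3 ⟨e1.symm, e2 ▸ hq⟩⟩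
    · exact Or.inr ⟨c, h, rfl, rfl⟩

theorem isOffspring_offspring (hi : 1 ≤ i) (hp : p ∈ J D i) :
    IsOffspring D (offspring D i p) i p := by
  obtain ⟨h1, h2, h3⟩ := mem_J.1 hp
  refine ⟨hi, h1, h2, ?_, ?_, ?_, ?_, h3, ?_⟩
  · intro c hc hcp
    have hJ : c ∈ J D i ↔ (i + 1, c) ∉ D := by
      rw [mem_J]
      exact ⟨fun h => h.2.2, fun h => ⟨hc, fun c' h4 h5 => h2 c' h4 (by omega), h⟩⟩
    have := h2 c hc hcp.le
    rw [mem_offspring, hJ]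
    simp [this, hcp, hcp.ne]
  · intro c hc hcp
    have hJ : c ∈ J D i ↔ (i + 1, c) ∉ D := by
      rw [mem_J]
      exact ⟨fun h => h.2.2, fun h => ⟨hc, fun c' h4 h5 => h2 c' h4 (by omega), h⟩⟩
    rw [mem_offspring, hJ]
    simp [hcp, em]
  · simp [mem_offspring]
  · simp [mem_offspring, h3]
  · intro r c hc h
    rw [mem_offspring]
    constructor
    · rintro (h4 | ⟨rfl, -, h4⟩)
      · exact h4.1
      · omega
    · exact fun h4 => Or.inl ⟨h4, by omega, by omega⟩

theorem IsPipeDream.offspring (hD : IsPipeDream D) : IsPipeDream (offspring D i p) := by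
  rintro ⟨r, c⟩ h
  rcases mem_offspring.1 h with h | ⟨rfl, h, -⟩
  · exact hD _ h.1
  · exact ⟨by simp, (mem_J.1 h).1⟩

theorem IsOffspring.mem_J (h : IsOffspring D E i p) : p ∈ J D i :=
  PipeDreams.mem_J.2 ⟨h.col_pos, h.top_mem, h.bot_notMem'⟩

theorem IsOffspring.right_unique {E' : Finset (ℕ × ℕ)} (h : IsOffspring D E i p)
    (h' : IsOffspring D E' i p) (hE : IsPipeDream E) (hE' : IsPipeDream E') : E = E' := by
  ext ⟨r, c⟩
  rcases Nat.eq_zero_or_pos c with rfl | hc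
  · have h1 : (r, 0) ∉ E := fun h => absurd (hE _ h).2 (by simp)
    have h2 : (r, 0) ∉ E' := fun h => absurd (hE' _ h).2 (by simp)
    simp [h1, h2]
  by_cases ho : (r ≠ i ∧ r ≠ i + 1) ∨ p < c
  · rw [h.other r c hc ho, h'.other r c hc ho]
  rcases (show c ≤ p by omega).lt_or_eq with hlt | rfl
  · rcases (show r = i ∨ r = i + 1 by omega) with rfl | rfl
    · rw [h.top_iff c hc hlt, h'.top_iff c hc hlt]
    · simp [h.bot_mem c hc hlt, h'.bot_mem c hc hlt]
  · rcases (show r = i ∨ r = i + 1 by omega) with rfl | rfl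
    · simp [h.top_notMem, h'.top_notMem]
    · simp [h.bot_notMem, h'.bot_notMem]

/-- The column can be read off `E`: it is that of the leftmost elbow in row `i + 1`. -/
theorem IsOffspring.col_unique (h : IsOffspring D E i p) (h' : IsOffspring D' E i p') :
    p = p' := by
  rcases lt_trichotomy p p' with h1 | h1 | h1
  · exact absurd (h'.bot_mem p h.col_pos h1) h.bot_notMem
  · exact h1
  · exact absurd (h.bot_mem p' h'.col_pos h1) h'.bot_notMem

theorem IsOffspring.left_unique (h : IsOffspring D E i p) (h' : IsOffspring D' E i p')
    (hD : IsPipeDream D) (hD' : IsPipeDream D') : D = D' := by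
  obtain rfl := h.col_unique h'
  ext ⟨r, c⟩
  rcases Nat.eq_zero_or_pos c with rfl | hc
  · have h1 : (r, 0) ∉ D := fun h => absurd (hD _ h).2 (by simp)
    have h2 : (r, 0) ∉ D' := fun h => absurd (hD' _ h).2 (by simp)
    simp [h1, h2]
  by_cases ho : (r ≠ i ∧ r ≠ i + 1) ∨ p < c
  · rw [← h.other r c hc ho, h'.other r c hc ho]
  have hcp : c ≤ p := by omega
  rcases (show r = i ∨ r = i + 1 by omega) with rfl | rfl
  · simp [h.top_mem c hc hcp, h'.top_mem c hc hcp]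
  · rcases hcp.lt_or_eq with hlt | rfl
    · rw [← h.top_iff c hc hlt, h'.top_iff c hc hlt]
    · simp [h.bot_notMem', h'.bot_notMem']

theorem IsOffspring.eq_offspring (h : IsOffspring D E i p) (hD : IsPipeDream D)
    (hE : IsPipeDream E) : E = PipeDreams.offspring D i p :=
  h.right_unique (isOffspring_offspring h.row_pos h.mem_J) hE hD.offspring

/-- The moved crosses land on boxes outside `D`, so only the cross at `(i, p)` is lost. -/
theorem card_offspring (hp : p ∈ J D i) : (offspring D i p).card + 1 = D.card := by
  obtain ⟨h1, h2, -⟩ := mem_J.1 hp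
  rw [offspring, Finset.card_union_of_disjoint, Finset.card_sdiff_of_subset,
    Finset.card_image_of_injective, Finset.card_image_of_injective,
    Nat.sub_add_cancel, Finset.card_erase_add_one (h2 p h1 le_rfl)]
  · rw [← Finset.card_image_of_injective _ (Prod.mk_right_injective i)]
    refine Finset.card_le_card ?_
    intro b hb
    simp only [Finset.mem_image, Finset.mem_filter] at hb
    obtain ⟨q, ⟨hq, hqp⟩, rfl⟩ := hb
    obtain ⟨h3, h4, -⟩ := mem_J.1 hq
    simp [hqp.ne, h4 q h3 le_rfl]
  · exact Prod.mk_right_injective _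
  · exact Prod.mk_right_injective _
  · intro b hb
    simp only [Finset.mem_image, Finset.mem_filter] at hb
    obtain ⟨q, ⟨hq, hqp⟩, rfl⟩ := hb
    obtain ⟨h3, h4, -⟩ := mem_J.1 hq
    simp [hqp.ne, h4 q h3 le_rfl]
  · rw [Finset.disjoint_left]
    intro b hb hb'
    simp only [Finset.mem_image, Finset.mem_filter] at hb'
    obtain ⟨q, ⟨hq, hqp⟩, rfl⟩ := hb'
    have := (mem_J.1 hq).2.2
    simp [this] at hb

/-! ### Undoing mitosis -/

/-- In a reduced pipe dream whose pipes entering in rows `i` and `i + 1` do not cross, the leftmost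
elbow of row `i + 1` has an elbow above it. -/
theorem notMem_of_leftmost_elbow {x y : ℕ} (hr : IsReduced E) (hi : 1 ≤ i)
    (hx : Exits E i x) (hy : Exits E (i + 1) y) (hxy : x < y) (hp : 1 ≤ p)
    (hrow : ∀ c, 1 ≤ c → c < p → (i + 1, c) ∈ E) (hel : (i + 1, p) ∉ E) : (i, p) ∉ E := by
  intro hmem
  have hb : Enters E (i + 1) i p Side.bottom :=
    (Enters.left_of_forall_mem (by omega) hrow hp).elbow_left hel
  obtain ⟨k, hk, hkp⟩ := exists_enters E i p Side.left hp (fun _ => hi)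
  -- The horizontal pipe `k` at `(i, p)` is followed back along row `i`. Either it started there, or
  -- it came up through row `i + 1`, where it met pipe `i + 1` at a cross; then the cross at `(i,
  -- p)` would be their second.
  have key : ∀ c, 1 ≤ c → c ≤ p → Enters E k i c Side.left →
      k = i ∨ ∃ c', CrossAt E k (i + 1) (i + 1, c') := by
    intro c hc
    induction c, hc using Nat.le_induction with
    | base => exact fun _ h => Or.inl (h.pipe_unique .start)
    | succ c hc ih =>
      intro hcp h
      obtain ⟨i, rfl⟩ : ∃ j, i = j + 1 := ⟨i - 1, by omega⟩
      cases h with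
      | start => omega
      | cross_left h _ => exact ih (by omega) h
      | elbow_bottom h hb =>
        right
        have hc1 := hrow c hc (by omega)
        refine ⟨c, hc1, Or.inr ⟨?_, ?_⟩⟩
        · exact Enters.left_of_forall_mem (by omega) (fun c' h1 h2 => hrow c' h1 (by omega)) hc
        · cases h with
          | cross_bottom h _ => exact h
          | elbow_left _ h => exact absurd hc1 h
  have hx1 : CrossAt E k (i + 1) (i, p) := ⟨hmem, Or.inl ⟨hkp, hb⟩⟩
  rcases key p hp le_rfl hkp with rfl | ⟨c', hc'⟩
  · have := exits_lt_of_crossAt hi (Nat.lt_succ_self k) hx1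
      (fun b' hb' => hr k (k + 1) hi (by omega) (by omega) _ _ hb' hx1) hx hy
    omega
  · have := hr k (i + 1) hk (by omega) hx1.ne _ _ hx1 hc'
    simp at this

theorem exists_isOffspring {x y : ℕ} (hE : IsPipeDream E) (hr : IsReduced E) (hi : 1 ≤ i)
    (hx : Exits E i x) (hy : Exits E (i + 1) y) (hxy : x < y) :
    ∃ D p, IsPipeDream D ∧ IsOffspring D E i p := by
  classical
  have hex := exists_notMem_row E (i + 1)
  obtain ⟨p, ⟨hp, hel⟩, hmin⟩ : ∃ p, (1 ≤ p ∧ (i + 1, p) ∉ E) ∧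
      ∀ c, c < p → ¬ (1 ≤ c ∧ (i + 1, c) ∉ E) :=
    ⟨Nat.find hex, Nat.find_spec hex, fun c hc => Nat.find_min hex hc⟩
  have hrow : ∀ c, 1 ≤ c → c < p → (i + 1, c) ∈ E := by
    intro c h1 h2
    by_contra h3
    exact hmin c h2 ⟨h1, h3⟩
  have htop := notMem_of_leftmost_elbow hr hi hx hy hxy hp hrow hel
  -- Row `i` is filled up to column `p`, and the part of row `i` of `E` left of `p` is put back into
  -- row `i + 1`.
  let D : Finset (ℕ × ℕ) := (E.filter fun b => (b.1 ≠ i ∧ b.1 ≠ i + 1) ∨ p < b.2) ∪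
    ((Finset.Icc 1 p).image fun c => (i, c)) ∪
    (((Finset.Ico 1 p).filter fun c => (i, c) ∈ E).image fun c => (i + 1, c))
  have hD : ∀ r c, (r, c) ∈ D ↔ ((r, c) ∈ E ∧ ((r ≠ i ∧ r ≠ i + 1) ∨ p < c)) ∨
      (r = i ∧ 1 ≤ c ∧ c ≤ p) ∨ (r = i + 1 ∧ 1 ≤ c ∧ c < p ∧ (i, c) ∈ E) := by
    intro r c
    simp only [D, Finset.mem_union, Finset.mem_filter, Finset.mem_image, Finset.mem_Icc,
      Finset.mem_Ico, Prod.mk.injEq, or_assoc]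
    refine or_congr Iff.rfl (or_congr ?_ ?_)
    · constructor
      · rintro ⟨c', h, rfl, rfl⟩
        exact ⟨rfl, h⟩
      · rintro ⟨rfl, h⟩
        exact ⟨c, h, rfl, rfl⟩
    · constructor
      · rintro ⟨c', h, rfl, rfl⟩
        exact ⟨rfl, h.1.1, h.1.2, h.2⟩
      · rintro ⟨rfl, h1, h2, h3⟩
        exact ⟨c, ⟨⟨h1, h2⟩, h3⟩, rfl, rfl⟩
  refine ⟨D, p, ?_, hi, hp, ?_, ?_, hrow, htop, hel, ?_, ?_⟩
  · rintro ⟨r, c⟩ h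
    rcases (hD r c).1 h with h | ⟨rfl, h, -⟩ | ⟨rfl, h, -⟩
    · exact hE _ h.1
    · exact ⟨hi, h⟩
    · exact ⟨by simp, h⟩
  · exact fun c h1 h2 => (hD _ _).2 (Or.inr (Or.inl ⟨rfl, h1, h2⟩))
  · intro c h1 h2
    rw [hD]
    simp [h1, h2, h2.le]
  · rw [hD]
    simp
  · intro r c hc h
    rw [hD]
    constructor
    · exact fun h' => Or.inl ⟨h', h⟩
    · rintro (h' | h' | h')
      · exact h'.1
      · omega
      · omega

/-! ### Inversions under `simple i`, and the first claim -/

/-- Applying `simple i` to both entries carries the inversions of `w` to those of the product other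
than `(a, b)`. -/
theorem length_mul_simple {i : Fin (n - 1)}
    (h : w ⟨i, by omega⟩ < w ⟨(i : ℕ) + 1, by omega⟩) :
    length (w * simple i) = length w + 1 := by
  set a : Fin n := ⟨i, by omega⟩ with ha
  set b : Fin n := ⟨(i : ℕ) + 1, by omega⟩ with hb
  have hs : simple i = Equiv.swap a b := rfl
  have hsa : simple i a = b := Equiv.swap_apply_left _ _
  have hsb : simple i b = a := Equiv.swap_apply_right _ _
  have hab : a < b := Fin.mk_lt_mk.2 (Nat.lt_succ_self _)
  have hlt : ∀ x y : Fin n, x < y → ¬ (x = a ∧ y = b) → simple i x < simple i y := by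
    intro x y hxy hne
    have hav : (a : ℕ) = i := rfl
    have hbv : (b : ℕ) = i + 1 := rfl
    simp only [hs, Equiv.swap_apply_def, Fin.ext_iff, Fin.lt_def] at hxy hne ⊢
    split_ifs <;> omega
  have hinj : Function.Injective (fun q : Fin n × Fin n => (simple i q.1, simple i q.2)) := by
    rintro ⟨x, y⟩ ⟨x', y'⟩ e
    simpa using e
  have hset : (Finset.univ.filter fun q : Fin n × Fin n =>
      q.1 < q.2 ∧ (w * simple i) q.2 < (w * simple i) q.1) =
      insert (a, b) ((Finset.univ.filter fun q : Fin n × Fin n =>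
        q.1 < q.2 ∧ w q.2 < w q.1).image fun q => (simple i q.1, simple i q.2)) := by
    ext ⟨x, y⟩
    rw [Finset.mem_filter]
    simp only [Finset.mem_filter, Finset.mem_univ, true_and, Finset.mem_insert, Finset.mem_image,
      Prod.mk.injEq, Prod.exists, Equiv.Perm.mul_apply]
    constructor
    · rintro ⟨h1, h2⟩
      by_cases e : x = a ∧ y = b
      · exact Or.inl e
      · exact Or.inr ⟨simple i x, simple i y, ⟨hlt x y h1 e, h2⟩, simple_simple _ _,
          simple_simple _ _⟩
    · rintro (⟨rfl, rfl⟩ | ⟨x', y', ⟨h1, h2⟩, rfl, rfl⟩)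
      · exact ⟨hab, by rwa [hsa, hsb]⟩
      · refine ⟨hlt x' y' h1 ?_, by simpa [simple_simple] using h2⟩
        rintro ⟨rfl, rfl⟩
        exact absurd h2 h.not_gt
  unfold length
  rw [hset, Finset.card_insert_of_notMem, Finset.card_image_of_injective _ hinj]
  · simp only [Finset.mem_filter, Finset.mem_univ, true_and, Finset.mem_image, Prod.mk.injEq,
      Prod.exists, not_exists, not_and]
    rintro x y ⟨h1, -⟩ h2 h3
    have h4 : x = b := by rw [← simple_simple i x, h2, hsa]
    have h5 : y = a := by rw [← simple_simple i y, h3, hsb]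
    rw [h4, h5] at h1
    exact absurd h1 hab.not_gt

theorem mul_simple_mul_simple (w : Equiv.Perm (Fin n)) (i : Fin (n - 1)) :
    w * simple i * simple i = w := by
  rw [mul_assoc, simple_mul_self, mul_one]

theorem length_eq_of_descent {i : Fin (n - 1)}
    (h : w ⟨(i : ℕ) + 1, by omega⟩ < w ⟨i, by omega⟩) :
    length w = length (w * simple i) + 1 := by
  conv_lhs => rw [← mul_simple_mul_simple w i]
  apply length_mul_simple
  simpa [simple] using h

theorem descent_of_length_lt {i : Fin (n - 1)} (h : length (w * simple i) < length w) :
    w ⟨(i : ℕ) + 1, by omega⟩ < w ⟨i, by omega⟩ := by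
  by_contra! hle
  have := length_mul_simple (lt_of_le_of_ne hle (by simp))
  omega

theorem mem_RP_iff_card : D ∈ RP w ↔ IsPipeDream D ∧ HasPerm D w ∧ D.card = length w := by
  rw [mem_RP]
  constructor
  · rintro ⟨h1, h2, h3⟩
    exact ⟨h1, h3, (h3.isReduced_iff h1).1 h2⟩
  · rintro ⟨h1, h3, h2⟩
    exact ⟨h1, (h3.isReduced_iff h1).2 h2, h3⟩

theorem RP_mul_simple {i : Fin (n - 1)} (h : length (w * simple i) < length w) :
    RP (w * simple i) = mitosisSet ((i : ℕ) + 1) (RP w) := by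
  have hdes := descent_of_length_lt h
  have hlen := length_eq_of_descent hdes
  ext E
  simp only [mitosisSet, Set.mem_iUnion, exists_prop, mitosis, Set.mem_ofPred_eq]
  constructor
  · intro hE
    obtain ⟨h1, h2, h3⟩ := mem_RP.1 hE
    have hx := h3.1 ⟨i, by omega⟩
    have hy := h3.1 ⟨(i : ℕ) + 1, by omega⟩
    obtain ⟨D, p, hD, ho⟩ := exists_isOffspring h1 h2 (by omega) hx hy (by
      simpa [simple] using hdes)
    have he := ho.eq_offspring hD h1
    refine ⟨D, mem_RP_iff_card.2 ⟨hD, ?_, ?_⟩, p, ho.mem_J, he⟩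
    · have := ho.hasPerm' h3
      rwa [mul_simple_mul_simple] at this
    · rw [hlen, ← (mem_RP_iff_card.1 hE).2.2, he, card_offspring ho.mem_J]
  · rintro ⟨D, hD, p, hp, rfl⟩
    obtain ⟨h1, h2, h3⟩ := mem_RP_iff_card.1 hD
    refine mem_RP_iff_card.2 ⟨h1.offspring,
      (isOffspring_offspring (by omega) hp).hasPerm h2, ?_⟩
    have := card_offspring hp
    omega

theorem pairwiseDisjoint_mitosis {P : Set (Finset (ℕ × ℕ))} (hP : ∀ D ∈ P, IsPipeDream D)
    (hi : 1 ≤ i) : P.PairwiseDisjoint (mitosis i) := by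
  intro D hD D' hD' hne
  refine Set.disjoint_left.2 ?_
  rintro E ⟨p, hp, rfl⟩ ⟨p', hp', e⟩
  have h := isOffspring_offspring hi hp
  have h' := isOffspring_offspring hi hp'
  rw [← e] at h'
  exact hne (h.left_unique h' (hP D hD) (hP D' hD'))

/-! ### The pipe dream of the long permutation -/

/-- A pipe that starts below all the crosses zigzags. -/
theorem Enters.bottom_of_forall_notMem (hrow : ∀ r c, r + c = k ∨ r + c = k + 1 → (r, c) ∉ D)
    (hr : r < k) : Enters D k r (k - r) Side.bottom := by
  obtain ⟨d, rfl⟩ : ∃ d, k = r + (d + 1) := ⟨k - r - 1, by omega⟩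
  rw [show r + (d + 1) - r = d + 1 by omega]
  induction d generalizing r with
  | zero => exact Enters.elbow_left .start (hrow _ _ (by omega))
  | succ d ih =>
    have := ih (r := r + 1) (by intro r' c h; exact hrow _ _ (by omega)) (by omega)
    rw [show r + 1 + (d + 1) = r + (d + 1 + 1) by omega] at this
    exact (this.elbow_bottom (hrow _ _ (by omega))).elbow_left (hrow _ _ (by omega))

theorem Enters.bottom_of_forall_not_crossAt (hx : ∀ l b, ¬ CrossAt D k l b)
    (hr : r < k) : Enters D k r (k - r) Side.bottom := by
  obtain ⟨d, rfl⟩ : ∃ d, k = r + (d + 1) := ⟨k - r - 1, by omega⟩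
  rw [show r + (d + 1) - r = d + 1 by omega]
  have hnl : ∀ {r' c}, 1 ≤ c → Enters D (r + (d + 1)) (r' + 1) c Side.left →
      (r' + 1, c) ∉ D := by
    intro r' c hc h hmem
    obtain ⟨l, -, hl⟩ := exists_enters D (r' + 1) c Side.bottom hc (by simp)
    exact hx l _ ⟨hmem, Or.inl ⟨h, hl⟩⟩
  have hnb : ∀ {r' c}, 1 ≤ c → Enters D (r + (d + 1)) (r' + 1) c Side.bottom →
      (r' + 1, c) ∉ D := by
    intro r' c hc h hmem
    obtain ⟨l, -, hl⟩ := exists_enters D (r' + 1) c Side.left hc (by simp)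
    exact hx l _ ⟨hmem, Or.inr ⟨hl, h⟩⟩
  have key : ∀ m, m ≤ d → Enters D (r + (d + 1)) (r + (d - m)) (m + 1) Side.bottom := by
    intro m
    induction m with
    | zero =>
      intro _
      exact Enters.elbow_left .start (hnl le_rfl .start)
    | succ m ih =>
      intro hm
      have h1 := ih (by omega)
      rw [show r + (d - m) = r + (d - (m + 1)) + 1 by omega] at h1
      have h2 := h1.elbow_bottom (hnb (by omega) h1)
      exact h2.elbow_left (hnl (by omega) h2)
  simpa using key d le_rfl

/-- If `r + c > n`, pipe `r + c` is in no inversion, so it crosses nothing and zigzags along its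
antidiagonal. It thus enters `(r, c)` from below, and a cross there would be a crossing. -/
theorem subset_D₀_of_mem_RP (h : D ∈ RP w) : D ⊆ D₀ n := by
  obtain ⟨hD, hr, hp⟩ := mem_RP.1 h
  rintro ⟨r, c⟩ hb
  obtain ⟨h1, h2⟩ := hD _ hb
  simp only at h1 h2
  have hle : r + c ≤ n := by
    by_contra! hlt
    have hno : ∀ l b, 1 ≤ l → ¬ CrossAt D (r + c) l b := by
      intro l b hl hx
      rcases hx.ne.lt_or_gt with h | h
      · obtain ⟨i, j, -, -, e1, e2⟩ := hp.inverted_of_crossAt hr (by omega) h hx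
        omega
      · obtain ⟨i, j, -, -, e1, e2⟩ := hp.inverted_of_crossAt hr hl h hx.symm
        omega
    -- `CrossAt` allows the index `0`, but the two pipes at a box of `D` start in positive rows.
    have hno' : ∀ l b, ¬ CrossAt D (r + c) l b := by
      intro l b hx
      obtain ⟨k', l', hk', hkl, hx'⟩ := hD.exists_crossAt hx.1
      have := hx.pair_eq hx'
      exact hno l b (by omega) hx
    have hz : Enters D (r + c) r (r + c - r) Side.bottom :=
      Enters.bottom_of_forall_not_crossAt hno' (by omega)
    rw [Nat.add_sub_cancel_left] at hz
    obtain ⟨l, -, hl⟩ := exists_enters D r c Side.left h2 (fun _ => h1)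
    exact hno' l (r, c) ⟨hb, Or.inr ⟨hl, hz⟩⟩
  simp only [D₀, Finset.mem_filter, Finset.mem_product, Finset.mem_Icc]
  omega

theorem mem_D₀ : (r, c) ∈ D₀ n ↔ 1 ≤ r ∧ 1 ≤ c ∧ r + c ≤ n := by
  simp only [D₀, Finset.mem_filter, Finset.mem_product, Finset.mem_Icc]
  omega

theorem D₀_enters_left (hr : 1 ≤ r) (hc : 1 ≤ c) (h : r + c ≤ n + 1) :
    Enters (D₀ n) r r c Side.left :=
  Enters.left_of_forall_mem hr (fun c' h1 h2 => mem_D₀.2 ⟨hr, h1, by omega⟩) hc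

theorem D₀_enters_bottom (hc : 1 ≤ c) (h : r + c ≤ n) :
    Enters (D₀ n) (n + 1 - c) r c Side.bottom := by
  obtain ⟨d, rfl⟩ : ∃ d, n = r + c + d := ⟨n - (r + c), by omega⟩
  induction d generalizing r with
  | zero =>
    have := D₀_enters_left (n := r + c + 0) (r := r + 1) (c := c) (by omega) hc (by omega)
    rw [show r + c + 0 + 1 - c = r + 1 by omega]
    exact this.elbow_left fun h => by
      have := mem_D₀.1 h
      omega
  | succ d ih =>
    have := ih (r := r + 1) (by omega)
    rw [show r + 1 + c + d = r + c + (d + 1) by omega] at this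
    exact this.cross_bottom (mem_D₀.2 ⟨by omega, hc, by omega⟩)

theorem D₀_mem_RP : D₀ n ∈ RP (w₀ n) := by
  refine ⟨?_, ?_, ?_, ?_⟩
  · rintro ⟨r, c⟩ h
    have := mem_D₀.1 h
    exact ⟨this.1, this.2.1⟩
  · rintro k l - - - ⟨r, c⟩ ⟨r', c'⟩ h h'
    -- Since `r < n + 1 - c`, the unordered pair of pipes determines the box.
    have key : ∀ r c, (r, c) ∈ D₀ n → CrossAt (D₀ n) r (n + 1 - c) (r, c) := by
      intro r c h
      obtain ⟨h1, h2, h3⟩ := mem_D₀.1 h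
      exact ⟨h, Or.inl ⟨D₀_enters_left h1 h2 (by omega), D₀_enters_bottom h2 h3⟩⟩
    have h1 := mem_D₀.1 h.1
    have h2 := mem_D₀.1 h'.1
    have h3 := h.pair_eq (key _ _ h.1)
    have h4 := h'.pair_eq (key _ _ h'.1)
    simp only [Prod.mk.injEq]
    omega
  · intro i
    have := D₀_enters_bottom (n := n) (r := 0) (c := n - i) (by omega) (by omega)
    rw [show n + 1 - (n - (i : ℕ)) = i + 1 by omega] at this
    have e : ((w₀ n i : Fin n) : ℕ) + 1 = n - i := by
      simp [w₀, Fin.val_rev]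
      omega
    rw [e]
    exact this
  · intro k hk
    have := Enters.bottom_of_forall_notMem (D := D₀ n) (k := k) (r := 0) (by
      intro r c h hm
      have := mem_D₀.1 hm
      omega) (by omega)
    exact this

theorem RP_w₀ : RP (w₀ n) = {D₀ n} := by
  ext D
  constructor
  · intro h
    refine Finset.eq_of_subset_of_card_le (subset_D₀_of_mem_RP h) ?_
    rw [(mem_RP_iff_card.1 h).2.2, (mem_RP_iff_card.1 (D₀_mem_RP (n := n))).2.2]
  · rintro rfl
    exact D₀_mem_RP

/-! ### Reduced words, and the second claim -/

theorem length_prod_le (l : List (Fin (n - 1))) : length (l.map simple).prod ≤ l.length := by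
  induction l using List.reverseRecOn with
  | nil =>
    simp only [List.map_nil, List.prod_nil, length, Equiv.Perm.coe_one, id, List.length_nil,
      Nat.le_zero, Finset.card_eq_zero, Finset.filter_eq_empty_iff]
    exact fun q _ h => h.1.not_gt h.2
  | append_singleton l i ih =>
    simp only [List.map_append, List.map_cons, List.map_nil, List.prod_append, List.prod_cons,
      List.prod_nil, mul_one, List.length_append, List.length_cons, List.length_nil]
    rcases lt_or_ge (length ((l.map simple).prod * simple i)) (length (l.map simple).prod)
      with h | h
    · omega
    · have : (l.map simple).prod ⟨i, by omega⟩ <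
          (l.map simple).prod ⟨(i : ℕ) + 1, by omega⟩ := by
        by_contra! hle
        have := length_eq_of_descent (lt_of_le_of_ne hle (by simp))
        omega
      rw [length_mul_simple this]
      omega

/-- Descents are stripped off one at a time; a permutation without descents is monotone, hence the
identity. -/
theorem exists_word_of_length (v : Equiv.Perm (Fin n)) :
    ∃ l : List (Fin (n - 1)), (l.map simple).prod = v ∧ l.length = length v := by
  induction hm : length v using Nat.strong_induction_on generalizing v with
  | _ m ih =>
    by_cases hdes : ∃ i : Fin (n - 1), v ⟨(i : ℕ) + 1, by omega⟩ < v ⟨i, by omega⟩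
    · obtain ⟨i, hi⟩ := hdes
      have hlen := length_eq_of_descent hi
      obtain ⟨l, h1, h2⟩ := ih _ (by omega) (v * simple i) rfl
      refine ⟨l ++ [i], ?_, ?_⟩
      · simp [h1, mul_simple_mul_simple]
      · simp only [List.length_append, List.length_cons, List.length_nil]
        omega
    · push Not at hdes
      have hmono : Monotone v := by
        cases n with
        | zero => exact fun x => x.elim0
        | succ n => exact Fin.monotone_iff_le_succ.2 fun i => hdes i
      have hv : v = 1 := by
        have hs : StrictMono v := hmono.strictMono_of_injective v.injective
        ext x
        have := (Subsingleton.elim (hs.orderIsoOfSurjective v v.surjective)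
          (OrderIso.refl (Fin n)))
        have h2 := congrArg (fun f : Fin n ≃o Fin n => f x) this
        simpa using congrArg Fin.val h2
      refine ⟨[], by simp [hv], ?_⟩
      have := length_prod_le (n := n) []
      simp only [List.map_nil, List.prod_nil, List.length_nil] at this
      rw [← hm, hv]
      simp only [List.length_nil]
      omega

theorem IsReducedExpression.length_eq {l : List (Fin (n - 1))} {v : Equiv.Perm (Fin n)}
    (h : IsReducedExpression l v) : l.length = length v := by
  obtain ⟨l', h1, h2⟩ := exists_word_of_length v
  have h3 := h.2 l' h1
  have h4 := length_prod_le l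
  rw [h.1] at h4
  omega

/-- Prefixes inherit the length condition, so the last letter acts at an ascent of the prefix; `w₀
n` on the left reverses values and makes it a descent, as `RP_mul_simple` needs. -/
theorem RP_w₀_mul_prod (l : List (Fin (n - 1))) (h : length (l.map simple).prod = l.length) :
    RP (w₀ n * (l.map simple).prod) =
      l.foldl (fun (P : Set (Finset (ℕ × ℕ))) (i : Fin (n - 1)) => mitosisSet ((i : ℕ) + 1) P)
        {D₀ n} := by
  induction l using List.reverseRecOn with
  | nil => simp [RP_w₀]
  | append_singleton l i ih =>
    simp only [List.map_append, List.map_cons, List.map_nil, List.prod_append, List.prod_cons,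
      List.prod_nil, mul_one, List.length_append, List.length_cons, List.length_nil,
      List.foldl_append, List.foldl_cons, List.foldl_nil] at h ⊢
    have hle := length_prod_le l
    have hasc : (l.map simple).prod ⟨i, by omega⟩ <
        (l.map simple).prod ⟨(i : ℕ) + 1, by omega⟩ := by
      by_contra! hle'
      have := length_eq_of_descent (lt_of_le_of_ne hle' (by simp))
      omega
    have h1 := length_mul_simple hasc
    rw [← ih (by omega), ← mul_assoc]
    apply RP_mul_simple
    have hdes : (w₀ n * (l.map simple).prod) ⟨(i : ℕ) + 1, by omega⟩ <
        (w₀ n * (l.map simple).prod) ⟨i, by omega⟩ := by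
      simpa [w₀] using hasc
    have := length_eq_of_descent hdes
    omega

theorem w₀_mul_w₀ : w₀ n * w₀ n = 1 := by
  ext x
  simp [w₀]

end PipeDreams

theorem theorem4p1 (n : ℕ) :
    (∀ (w : Equiv.Perm (Fin n)) (i : Fin (n - 1)),
      PipeDreams.length (w * PipeDreams.simple i) < PipeDreams.length w →
        (PipeDreams.RP (w * PipeDreams.simple i) =
            (⋃ D ∈ PipeDreams.RP w, PipeDreams.mitosis ((i : ℕ) + 1) D)) ∧
          (PipeDreams.RP w).PairwiseDisjoint
            (fun D => PipeDreams.mitosis ((i : ℕ) + 1) D)) ∧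
    (∀ (w : Equiv.Perm (Fin n)) (l : List (Fin (n - 1))),
      PipeDreams.IsReducedExpression l (PipeDreams.w₀ n * w) →
        PipeDreams.RP w =
          l.foldl
            (fun (P : Set (Finset (ℕ × ℕ))) (i : Fin (n - 1)) =>
              PipeDreams.mitosisSet ((i : ℕ) + 1) P)
            {PipeDreams.D₀ n}) := by
  refine ⟨fun w i h => ⟨PipeDreams.RP_mul_simple h,
    PipeDreams.pairwiseDisjoint_mitosis (fun D hD => hD.1) (by omega)⟩, fun w l h => ?_⟩
  have h1 := h.length_eq
  -- As `w₀ n` is an involution, `w = w₀ n * (w₀ n * w)`.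
  rw [← PipeDreams.RP_w₀_mul_prod l (by rw [h.1, h1]), h.1, ← mul_assoc, PipeDreams.w₀_mul_w₀,
    one_mul]
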